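/- Let $d\ge 1$ and let $\Lambda\subset\mathbb{R}^d$ be a full-rank lattice of covolume $1$, with dual lattice $\Lambda^*=\{y\in\mathbb{R}^d : \langle y,x\rangle\in\mathbb{Z}\text{ for each }x\in\Lambda\}$, where $\langle\cdot,\cdot\rangle$ is the standard inner product. Let $\tau=(\tau_1,\dots,\tau_d)\in\mathbb{R}^d$ with $\tau_1+\dots+\tau_d=0$. For such a $\tau$ put $\mathcal{B}_\tau=\operatorname{diag}(e^{\tau_1},\dots,e^{\tau_d})\,\mathcal{B}$, where $\mathcal{B}=\{x\in\mathbb{R}^d : \max_i|x_i|\le 1\}$. For a lattice $M\subset\mathbb{R}^d$ and $1\le k\le d$ let $\lambda_k(\mathcal{B}_\tau,M)$ be the $k$-th successive minimum, that is, the infimum of the positive $\lambda$ such that $\lambda\mathcal{B}_\tau$ contains at least $k$ linearly independent vectors of $M$, and put $$L_k(\tau,M)=\log\lambda_k(\mathcal{B}_\tau,M),\qquad S_k(\tau,M)=\sum_{1\le j\le k}L_j(\tau,M).$$ Then: (i) $-\log d\le L_k(\tau,\Lambda)+L_{d+1-k}(-\tau,\Lambda^*)\le\log d!$ for every $k=1,\dots,d$;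 (ii) $-k\log d\le S_k(\tau,\Lambda)-S_{d-k}(-\tau,\Lambda^*)\le(k+1)\log d!$ for every $k=1,\dots,d-1$. -/

import Mathlib

noncomputable section

namespace MultParamGeom

/-- The standard inner product `⟨y, x⟩ = ∑ i, y i * x i` on `ℝ^d`, as a bilinear form. -/
def stdForm (d : ℕ) : LinearMap.BilinForm ℝ (Fin d → ℝ) :=
  dotProductBilin ℝ ℝ

/-- The dual lattice `Λ* = {y | ⟨y, x⟩ ∈ ℤ for each x ∈ Λ}`. -/
def dualLattice {d : ℕ} (Λ : Submodule ℤ (Fin d → ℝ)) : Submodule ℤ (Fin d → ℝ) :=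
  (stdForm d).dualSubmodule Λ

theorem mem_dualLattice {d : ℕ} (Λ : Submodule ℤ (Fin d → ℝ)) (y : Fin d → ℝ) :
    y ∈ dualLattice Λ ↔ ∀ x ∈ Λ, ∃ n : ℤ, ∑ i, y i * x i = (n : ℝ) := by
  simp only [dualLattice, LinearMap.BilinForm.mem_dualSubmodule, stdForm, Submodule.mem_one]
  refine forall₂_congr fun x _ => exists_congr fun n => ?_
  simp [dotProductBilin, dotProduct, eq_comm]

/-- The box `B_τ = D_τ B`, where `D_τ = diag (exp τ₁, …, exp τ_d)` and `B` is the closed unit ball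
of the sup-norm (which is the norm of the type `Fin d → ℝ`). -/
def box {d : ℕ} (τ : Fin d → ℝ) : Set (Fin d → ℝ) :=
  (Matrix.diagonal fun i => Real.exp (τ i)).mulVec '' Metric.closedBall 0 1

open scoped Pointwise in
/-- The `k`-th successive minimum of `B` with respect to `Λ`: the infimum of the positive `r` such
that `r B` contains at least `k` linearly independent vectors of `Λ`. -/
def succMin {d : ℕ} (B : Set (Fin d → ℝ)) (Λ : Submodule ℤ (Fin d → ℝ)) (k : ℕ) : ℝ :=
  sInf {r : ℝ | 0 < r ∧ ∃ v : Fin k → (Fin d → ℝ),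
    LinearIndependent ℝ v ∧ ∀ i, v i ∈ Λ ∧ v i ∈ r • B}

/-- `L_k(τ, Λ) = log λ_k(B_τ, Λ)`. -/
def L {d : ℕ} (k : ℕ) (τ : Fin d → ℝ) (Λ : Submodule ℤ (Fin d → ℝ)) : ℝ :=
  Real.log (succMin (box τ) Λ k)

/-- `S_k(τ, Λ) = ∑_{1 ≤ j ≤ k} L_j(τ, Λ)`. -/
def S {d : ℕ} (k : ℕ) (τ : Fin d → ℝ) (Λ : Submodule ℤ (Fin d → ℝ)) : ℝ :=
  ∑ j ∈ Finset.Icc 1 k, L j τ Λ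

end MultParamGeom

end

namespace MultParamGeom

open Module MeasureTheory

variable {d : ℕ}

/-! Rescaling by `scale (-τ)` turns the box into the unit cube, keeps the covolume since the `τ i`
sum to zero, and rescales the dual lattice inversely. The minima become the norms of successively
shortest independent vectors v_k of a unimodular lattice M and w_k of its dual M*.

Lower bound in (i): v_1, …, v_k and w_1, …, w_{d+1-k} are too many to be mutually orthogonal, so
some pairing is a nonzero integer, at most d‖v_k‖‖w_{d+1-k}‖ in absolute value. Upper bound: the
cofactor vectors c_j of the matrix with rows v_i lie in M*, and ‖v_j‖‖c_j‖ ≤ d! ∏‖v_i‖ ≤ d! by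
Minkowski's second theorem (`prod_le_abs_det`); the c_j with j ≥ k are numerous enough to bound
w_{d+1-k}.

For (ii), sum (i) over the first k indices. The result differs from the wanted expression by S_d(-τ,
Λ*), which lies in [-log d!, 0]; hence the extra log d! above. -/

/-! ### Minkowski's second theorem for the cube, by packing -/

/-- The endomorphism that is diagonal with entries `a` in the basis `B`. -/
noncomputable def diagEnd (B : Basis (Fin d) ℝ (Fin d → ℝ)) (a : Fin d → ℝ) :
    (Fin d → ℝ) →ₗ[ℝ] (Fin d → ℝ) :=
  Matrix.toLin B B (Matrix.diagonal a)

theorem repr_diagEnd (B : Basis (Fin d) ℝ (Fin d → ℝ)) (a x : Fin d → ℝ) (k : Fin d) :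
    B.repr (diagEnd B a x) k = a k * B.repr x k := by
  rw [diagEnd, Matrix.repr_toLin, Matrix.mulVec_diagonal]

theorem det_diagEnd (B : Basis (Fin d) ℝ (Fin d → ℝ)) (a : Fin d → ℝ) :
    LinearMap.det (diagEnd B a) = ∏ i, a i := by
  rw [diagEnd, LinearMap.det_toLin, Matrix.det_diagonal]

/-- An open set admits a measurable section with countably many values over its image under an
idempotent linear map. -/
theorem exists_measurable_section {π : (Fin d → ℝ) →ₗ[ℝ] (Fin d → ℝ)} (hπ : ∀ x, π (π x) = π x)
    {Q : Set (Fin d → ℝ)} (hQ : IsOpen Q) :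
    ∃ q : (Fin d → ℝ) → (Fin d → ℝ), Measurable q ∧ (Set.range q).Countable ∧
      (∀ x ∈ Q, π x + q x ∈ Q) ∧ (∀ x, π (q x) = 0) ∧
      ∀ x ∈ Q, ∀ y ∈ Q, π x = π y → q x = q y := by
  classical
  have hc : Continuous π := π.continuous_of_finiteDimensional
  set u := TopologicalSpace.denseSeq (Fin d → ℝ)
  -- The fibre of π through x meets Q in a relatively open set, so a dense sequence projected to ker
  -- π hits it. Taking the first such n makes the choice measurable and, on Q, dependent on π x
  -- alone.
  have hex : ∀ x, ∃ n, π x + (u n - π (u n)) ∈ Q ∨ x ∉ Q := by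
    intro x
    by_cases hx : x ∈ Q
    · have ho : IsOpen ((fun y => π x + (y - π y)) ⁻¹' Q) := hQ.preimage (by fun_prop)
      obtain ⟨n, hn⟩ := (TopologicalSpace.denseRange_denseSeq (Fin d → ℝ)).exists_mem_open
        ho ⟨x, by simpa using hx⟩
      exact ⟨n, Or.inl hn⟩
    · exact ⟨0, Or.inr hx⟩
  have hm : Measurable fun x => Nat.find (hex x) := by
    refine measurable_find hex fun n => ?_
    exact (hQ.preimage (f := fun x => π x + (u n - π (u n))) (by fun_prop)).measurableSet.union
      hQ.measurableSet.compl
  refine ⟨fun x => u (Nat.find (hex x)) - π (u (Nat.find (hex x))),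
    (measurable_from_nat (f := fun n => u n - π (u n))).comp hm,
    (Set.countable_range fun n => u n - π (u n)).mono ?_, ?_, ?_, ?_⟩
  · rintro _ ⟨x, rfl⟩
    exact ⟨_, rfl⟩
  · intro x hx
    exact (Nat.find_spec (hex x)).resolve_right (not_not.2 hx)
  · intro x
    simp [hπ]
  · intro x hx y hy hxy
    have : Nat.find (hex x) = Nat.find (hex y) := by
      congr 1
      ext n
      simp [hx, hy, hxy]
    simp only [this]

/-- The volume of the image of a set under an injective map that differs from a linear one by a
measurable function with countably many values. -/
theorem volume_image_linear_add {A : (Fin d → ℝ) →ₗ[ℝ] (Fin d → ℝ)}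
    {g : (Fin d → ℝ) → (Fin d → ℝ)} (hg : Measurable g) (hgc : (Set.range g).Countable)
    {Q : Set (Fin d → ℝ)} (hQ : MeasurableSet Q) (hinj : Set.InjOn (fun x => A x + g x) Q) :
    volume ((fun x => A x + g x) '' Q) = ENNReal.ofReal |LinearMap.det A| * volume Q := by
  have hA : Measurable A := A.continuous_of_finiteDimensional.measurable
  have hcover : Q = ⋃ t ∈ Set.range g, Q ∩ g ⁻¹' {t} := by
    ext x
    simp
  have hmeas : ∀ t, MeasurableSet (Q ∩ g ⁻¹' {t}) := fun t =>
    hQ.inter (hg (measurableSet_singleton t))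
  have hdisj : (Set.range g).PairwiseDisjoint fun t => Q ∩ g ⁻¹' {t} := by
    intro s _ t _ hst
    refine Set.disjoint_left.2 fun x hx hx' => hst ?_
    exact hx.2.symm.trans hx'.2
  have himage : ∀ t, volume ((fun x => A x + g x) '' (Q ∩ g ⁻¹' {t})) =
      ENNReal.ofReal |LinearMap.det A| * volume (Q ∩ g ⁻¹' {t}) := by
    intro t
    have : (fun x => A x + g x) '' (Q ∩ g ⁻¹' {t}) =
        (fun y => y + t) '' (A '' (Q ∩ g ⁻¹' {t})) := by
      rw [Set.image_image]
      refine Set.image_congr fun x hx => ?_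
      rw [show g x = t from hx.2]
    rw [this, Set.image_add_right, measure_preimage_add_right, Measure.addHaar_image_linearMap]
  conv_lhs => rw [hcover, Set.image_iUnion₂]
  conv_rhs => rw [hcover]
  rw [measure_biUnion hgc, measure_biUnion hgc hdisj fun t _ => hmeas t, ← ENNReal.tsum_mul_left]
  · exact tsum_congr fun t => himage t
  · intro s hs t ht hst
    refine Set.disjoint_left.2 ?_
    rintro _ ⟨x, hx, rfl⟩ ⟨y, hy, hxy⟩
    have : y = x := hinj hy.1 hx.1 hxy
    exact Set.disjoint_left.1 (hdisj hs ht hst) hx (this ▸ hy)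
  · intro t _
    exact (hmeas t).image_of_measurable_injOn (hA.add hg) (hinj.mono Set.inter_subset_left)

/-- A nonnegative monotone finite sequence is the sequence of partial sums of a nonnegative one. -/
theorem exists_nonneg_partial_sums {l : Fin d → ℝ} (hl : Monotone l) (h0 : ∀ i, 0 ≤ l i) :
    ∃ δ : Fin d → ℝ, (∀ i, 0 ≤ δ i) ∧ ∀ k, l k = ∑ i, if i ≤ k then δ i else 0 := by
  induction d with
  | zero => exact ⟨l, h0, fun k => k.elim0⟩
  | succ n ih =>
    obtain ⟨δ, hδ, hs⟩ := ih (l := fun i => l i.succ - l 0)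
      (fun i j hij => sub_le_sub_right (hl (Fin.succ_le_succ_iff.2 hij)) _)
      (fun i => sub_nonneg.2 (hl (Fin.zero_le _)))
    refine ⟨Fin.cons (l 0) δ, Fin.cases (h0 0) (by simpa using hδ), Fin.cases ?_ fun k => ?_⟩
    · simp
    · simp [Fin.sum_univ_succ, ← hs]

/-- Minkowski's second theorem for the cube: if a lattice vector shorter than `l k` always has
vanishing `k`-th coordinate, the product of the `l k` is at most the covolume. -/
theorem prod_le_abs_det {b : Basis (Fin d) ℝ (Fin d → ℝ)} (B : Basis (Fin d) ℝ (Fin d → ℝ))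
    {l : Fin d → ℝ} (hl : Monotone l) (h0 : ∀ i, 0 < l i)
    (hmin : ∀ z ∈ Submodule.span ℤ (Set.range b), ∀ k, ‖z‖ < l k → B.repr z k = 0) :
    ∏ i, l i ≤ |(Matrix.of b).det| := by
  -- Radius 1/2 gives volume 1, and differences of points of Q have norm below 1.
  set Q : Set (Fin d → ℝ) := Metric.ball 0 (1 / 2)
  obtain ⟨δ, hδ, hs⟩ := exists_nonneg_partial_sums hl fun i => (h0 i).le
  let π : Fin d → (Fin d → ℝ) →ₗ[ℝ] (Fin d → ℝ) := fun i =>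
    diagEnd B fun j => if i ≤ j then 1 else 0
  have hπr : ∀ i x k, B.repr (π i x) k = if i ≤ k then B.repr x k else 0 := by
    intro i x k
    rw [repr_diagEnd]
    split_ifs <;> simp
  have hπ : ∀ i x, π i (π i x) = π i x := by
    intro i x
    refine B.repr.injective (Finsupp.ext fun k => ?_)
    rw [hπr, hπr]
    split_ifs <;> rfl
  choose q hqm hqc hqQ hqπ hqq using fun i =>
    exists_measurable_section (hπ i) (Metric.isOpen_ball : IsOpen Q)
  have hqr : ∀ i x k, i ≤ k → B.repr (q i x) k = 0 := by
    intro i x k hik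
    have := hπr i (q i x) k
    rw [hqπ, if_pos hik] at this
    simpa using this.symm
  -- Q is deformed by x ↦ ∑ δ i • (π i x + q i x): a combination of points of Q whose linear part is
  -- diagonal with entries l, so the volume is multiplied by ∏ l. The translates of the image by
  -- lattice vectors will be disjoint.
  let g : (Fin d → ℝ) → (Fin d → ℝ) := fun x => ∑ i, δ i • q i x
  have hA : ∀ x, diagEnd B l x = ∑ i, δ i • π i x := by
    intro x
    refine B.repr.injective (Finsupp.ext fun k => ?_)
    rw [repr_diagEnd, hs, map_sum, Finsupp.finsetSum_apply, Finset.sum_mul]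
    refine Finset.sum_congr rfl fun i _ => ?_
    rw [map_smul, Finsupp.smul_apply, hπr]
    split_ifs <;> simp
  have hF : ∀ x, diagEnd B l x + g x = ∑ i, δ i • (π i x + q i x) := by
    intro x
    simp [hA, g, smul_add, Finset.sum_add_distrib]
  have hgm : Measurable g := Finset.measurable_sum _ fun i _ => (hqm i).const_smul (δ i)
  have hgc : (Set.range g).Countable := by
    refine ((Set.countable_univ_pi hqc).image fun t : Fin d → Fin d → ℝ =>
      ∑ i, δ i • t i).mono ?_
    rintro _ ⟨x, rfl⟩
    exact ⟨fun i => q i x, fun i _ => ⟨x, rfl⟩, rfl⟩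
  have hpack : ∀ x ∈ Q, ∀ y ∈ Q, diagEnd B l x + g x - (diagEnd B l y + g y) ∈
      Submodule.span ℤ (Set.range b) → x = y := by
    intro x hx y hy hxy
    by_contra hne
    have hex : (Finset.univ.filter fun k => B.repr x k ≠ B.repr y k).Nonempty := by
      by_contra hcon
      rw [Finset.not_nonempty_iff_eq_empty, Finset.filter_eq_empty_iff] at hcon
      refine hne (B.repr.injective (Finsupp.ext fun k => ?_))
      simpa using hcon (Finset.mem_univ k)
    -- Beyond the last differing coordinate k the summands cancel. The rest has norm below ∑_{i ≤ k}
    -- δ i = l k, yet its k-th coordinate is l k times a nonzero number, against `hmin`.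
    obtain ⟨k, hk⟩ : ∃ k, IsGreatest {k | B.repr x k ≠ B.repr y k} k :=
      ⟨_, by simpa using Finset.isGreatest_max' _ hex⟩
    have hπeq : ∀ i, k < i → π i x = π i y := by
      intro i hi
      refine B.repr.injective (Finsupp.ext fun j => ?_)
      rw [hπr, hπr]
      split_ifs with hij
      · by_contra hj
        exact absurd (hk.2 hj) (not_le.2 (hi.trans_le hij))
      · rfl
    have hsub : diagEnd B l x + g x - (diagEnd B l y + g y) =
        ∑ i, if i ≤ k then δ i • (π i x + q i x - (π i y + q i y)) else 0 := by
      rw [hF, hF, ← Finset.sum_sub_distrib]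
      refine Finset.sum_congr rfl fun i _ => ?_
      split_ifs with hik
      · rw [smul_sub]
      · rw [hqq i x hx y hy (hπeq i (not_le.1 hik)), hπeq i (not_le.1 hik), sub_self]
    have hlt : ∀ i, ‖π i x + q i x - (π i y + q i y)‖ < 1 := by
      intro i
      have h1 := hqQ i x hx
      have h2 := hqQ i y hy
      rw [mem_ball_zero_iff] at h1 h2
      exact (norm_sub_le _ _).trans_lt (by linarith)
    have hnorm : ‖diagEnd B l x + g x - (diagEnd B l y + g y)‖ < l k := by
      rw [hsub, hs k]
      have hpos : 0 < ∑ i, if i ≤ k then δ i else 0 := hs k ▸ h0 k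
      obtain ⟨i, -, hi⟩ := Finset.exists_lt_of_sum_lt (s := Finset.univ) (f := fun _ => (0 : ℝ))
        (by simpa using hpos)
      have hi' : i ≤ k ∧ 0 < δ i := by
        by_cases h : i ≤ k
        · exact ⟨h, by simpa [h] using hi⟩
        · simp [h] at hi
      refine (norm_sum_le _ _).trans_lt (Finset.sum_lt_sum (fun j _ => ?_)
        ⟨i, Finset.mem_univ _, ?_⟩)
      · split_ifs
        · rw [norm_smul, Real.norm_of_nonneg (hδ j)]
          exact mul_le_of_le_one_right (hδ j) (hlt j).le
        · simp
      · rw [if_pos hi'.1, if_pos hi'.1, norm_smul, Real.norm_of_nonneg (hδ i)]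
        exact mul_lt_of_lt_one_right hi'.2 (hlt i)
    have hzero := hmin _ hxy k hnorm
    rw [hsub, map_sum, Finsupp.finsetSum_apply] at hzero
    have hval : ∑ i, B.repr (if i ≤ k then δ i • (π i x + q i x - (π i y + q i y)) else 0) k =
        l k * (B.repr x k - B.repr y k) := by
      rw [hs k, Finset.sum_mul]
      refine Finset.sum_congr rfl fun i _ => ?_
      split_ifs with hik
      · simp [hπr, hqr _ _ _ hik, hik]
      · simp
    rw [hval] at hzero
    rcases mul_eq_zero.1 hzero with h | h
    · exact (h0 k).ne' h
    · exact hk.1 (sub_eq_zero.1 h)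
  have hinj : Set.InjOn (fun x => diagEnd B l x + g x) Q := by
    intro x hx y hy hxy
    refine hpack x hx y hy ?_
    rw [show diagEnd B l x + g x = diagEnd B l y + g y from hxy, sub_self]
    exact zero_mem _
  have hAm : Measurable (diagEnd B l) := (diagEnd B l).continuous_of_finiteDimensional.measurable
  have hvol := volume_image_linear_add hgm hgc (measurableSet_ball : MeasurableSet Q) hinj
  rw [det_diagEnd, Real.volume_pi_ball _ (by norm_num),
    abs_of_nonneg (Finset.prod_nonneg fun i _ => (h0 i).le)] at hvol
  -- Blichfeldt's principle: an image of volume above the covolume would meet a lattice translate of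
  -- itself.
  by_contra! hcon
  have : Countable (Submodule.span ℤ (Set.range b)).toAddSubgroup :=
    inferInstanceAs (Countable (Submodule.span ℤ (Set.range b)))
  obtain ⟨u, v, huv, hnd⟩ := exists_pair_mem_lattice_not_disjoint_vadd
    (ZSpan.isAddFundamentalDomain' b volume)
    ((measurableSet_ball : MeasurableSet Q).image_of_measurable_injOn
      (hAm.add hgm) hinj).nullMeasurableSet (by
      refine lt_of_lt_of_eq ?_ hvol.symm
      rw [ZSpan.volume_fundamentalDomain]
      simpa using (ENNReal.ofReal_lt_ofReal_iff_of_nonneg (abs_nonneg _)).2 hcon)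
  obtain ⟨z, hz1, hz2⟩ := Set.not_disjoint_iff.1 hnd
  obtain ⟨_, ⟨x, hx, rfl⟩, hxz⟩ := hz1
  obtain ⟨_, ⟨y, hy, rfl⟩, hyz⟩ := hz2
  have hdiff : diagEnd B l x + g x - (diagEnd B l y + g y) = (v : Fin d → ℝ) - u := by
    have := hxz.trans hyz.symm
    simp only [AddSubgroup.vadd_def, vadd_eq_add] at this
    rw [sub_eq_sub_iff_add_eq_add, add_comm]
    exact this
  have hxy : x = y := hpack x hx y hy (hdiff ▸ sub_mem v.2 u.2)
  subst hxy
  rw [sub_self] at hdiff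
  exact huv (Subtype.ext (sub_eq_zero.1 hdiff.symm).symm)

/-! ### Unimodular lattices, duality and rescaling -/

/-- A lattice of covolume one, presented by a basis. -/
def IsUnimodular (Λ : Submodule ℤ (Fin d → ℝ)) : Prop :=
  ∃ b : Basis (Fin d) ℝ (Fin d → ℝ),
    Λ = Submodule.span ℤ (Set.range b) ∧ |(Matrix.of b).det| = 1

theorem isUnimodular_of_covolume_eq_one {Λ : Submodule ℤ (Fin d → ℝ)} [DiscreteTopology Λ]
    [IsZLattice ℝ Λ] (hΛ : ZLattice.covolume Λ = 1) : IsUnimodular Λ := by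
  have : Module.Free ℤ Λ := ZLattice.module_free ℝ Λ
  have : Module.Finite ℤ Λ := ZLattice.module_finite ℝ Λ
  have hr : finrank ℤ Λ = d := by rw [ZLattice.rank ℝ Λ, finrank_fin_fun]
  let b : Basis (Fin d) ℤ Λ := finBasisOfFinrankEq ℤ Λ hr
  refine ⟨b.ofZLatticeBasis ℝ Λ, (b.ofZLatticeBasis_span ℝ Λ).symm, ?_⟩
  rw [← hΛ, ZLattice.covolume_eq_det Λ b]
  congr 3
  ext1 i
  exact b.ofZLatticeBasis_apply ℝ Λ i

theorem stdForm_apply (x y : Fin d → ℝ) : stdForm d x y = ∑ i, x i * y i := rfl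

theorem stdForm_isSymm : (stdForm d).IsSymm :=
  ⟨fun x y => dotProduct_comm x y⟩

theorem stdForm_nondegenerate : (stdForm d).Nondegenerate := by
  refine stdForm_isSymm.isRefl.nondegenerate_iff_separatingLeft.2 fun x hx => ?_
  exact dotProduct_self_eq_zero.1 (hx x)

theorem IsUnimodular.dualLattice {Λ : Submodule ℤ (Fin d → ℝ)} (hΛ : IsUnimodular Λ) :
    IsUnimodular (dualLattice Λ) := by
  obtain ⟨b, rfl, hb⟩ := hΛ
  refine ⟨(stdForm d).dualBasis stdForm_nondegenerate b,
    LinearMap.BilinForm.dualSubmodule_span_of_basis _ stdForm_nondegenerate b, ?_⟩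
  have h : Matrix.of ((stdForm d).dualBasis stdForm_nondegenerate b) *
      (Matrix.of b).transpose = 1 := by
    ext i j
    have := LinearMap.BilinForm.apply_dualBasis_left (B := stdForm d) stdForm_nondegenerate b i j
    rw [stdForm_apply] at this
    rw [Matrix.mul_apply, Matrix.one_apply]
    simpa [eq_comm] using this
  have h' := congrArg (fun M => |Matrix.det M|) h
  simpa [Matrix.det_mul, abs_mul, hb] using h'

/-- The coordinatewise multiplication by `exp (τ i)`. -/
noncomputable def scale (τ : Fin d → ℝ) : (Fin d → ℝ) ≃ₗ[ℝ] (Fin d → ℝ) where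
  toFun x i := Real.exp (τ i) * x i
  invFun x i := Real.exp (-τ i) * x i
  map_add' x y := by ext i; simp [mul_add]
  map_smul' c x := by ext i; simp; ring
  left_inv x := by ext i; simp [← mul_assoc, ← Real.exp_add]
  right_inv x := by ext i; simp [← mul_assoc, ← Real.exp_add]

theorem scale_apply (τ x : Fin d → ℝ) (i : Fin d) : scale τ x i = Real.exp (τ i) * x i := rfl

theorem scale_scale_neg (τ x : Fin d → ℝ) : scale τ (scale (-τ) x) = x := by
  ext i
  simp [scale_apply, ← mul_assoc, ← Real.exp_add]

theorem scale_neg_scale (τ x : Fin d → ℝ) : scale (-τ) (scale τ x) = x := by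
  ext i
  simp [scale_apply, ← mul_assoc, ← Real.exp_add]

/-- The image of a lattice under `scale τ`. -/
noncomputable def scaleLattice (τ : Fin d → ℝ) (Λ : Submodule ℤ (Fin d → ℝ)) : Submodule ℤ (Fin d → ℝ) :=
  Λ.map ((scale τ).toLinearMap.restrictScalars ℤ)

theorem scale_mem_scaleLattice {τ : Fin d → ℝ} {Λ : Submodule ℤ (Fin d → ℝ)} {x : Fin d → ℝ} :
    scale τ x ∈ scaleLattice τ Λ ↔ x ∈ Λ := by
  simp [scaleLattice]

theorem mem_scaleLattice {τ : Fin d → ℝ} {Λ : Submodule ℤ (Fin d → ℝ)} {x : Fin d → ℝ} :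
    x ∈ scaleLattice τ Λ ↔ scale (-τ) x ∈ Λ := by
  rw [← scale_mem_scaleLattice (τ := τ) (Λ := Λ), scale_scale_neg]

theorem dualLattice_scaleLattice (τ : Fin d → ℝ) (Λ : Submodule ℤ (Fin d → ℝ)) :
    dualLattice (scaleLattice (-τ) Λ) = scaleLattice τ (dualLattice Λ) := by
  ext y
  rw [mem_scaleLattice, mem_dualLattice, mem_dualLattice]
  constructor
  · intro h x hx
    obtain ⟨n, hn⟩ := h _ (scale_mem_scaleLattice.2 hx)
    refine ⟨n, hn ▸ Finset.sum_congr rfl fun i _ => ?_⟩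
    simp only [scale_apply]
    ring
  · intro h x hx
    rw [mem_scaleLattice, neg_neg] at hx
    obtain ⟨n, hn⟩ := h _ hx
    refine ⟨n, hn ▸ Finset.sum_congr rfl fun i _ => ?_⟩
    simp only [scale_apply, Pi.neg_apply]
    rw [mul_mul_mul_comm, ← Real.exp_add]
    simp

theorem IsUnimodular.scaleLattice {Λ : Submodule ℤ (Fin d → ℝ)} (hΛ : IsUnimodular Λ)
    {τ : Fin d → ℝ} (hτ : ∑ i, τ i = 0) : IsUnimodular (scaleLattice τ Λ) := by
  obtain ⟨b, rfl, hb⟩ := hΛ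
  refine ⟨b.map (scale τ), ?_, ?_⟩
  · rw [MultParamGeom.scaleLattice, Submodule.map_span, ← Set.range_comp]
    rfl
  · have : Matrix.of (b.map (scale τ)) =
        Matrix.of b * Matrix.diagonal fun i => Real.exp (τ i) := by
      ext i j
      simp [scale_apply, mul_comm]
    rw [this, Matrix.det_mul, Matrix.det_diagonal, ← Real.exp_sum, hτ, Real.exp_zero, mul_one, hb]

open scoped Pointwise in
theorem mem_smul_box {τ x : Fin d → ℝ} {r : ℝ} (hr : 0 < r) :
    x ∈ r • box τ ↔ ‖scale (-τ) x‖ ≤ r := by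
  have hbox : box τ = scale τ '' Metric.closedBall 0 1 := by
    refine Set.image_congr fun x _ => ?_
    ext i
    rw [Matrix.mulVec_diagonal, scale_apply]
  rw [hbox, ← image_smul_set, smul_unitClosedBall_of_nonneg hr.le, ← mem_closedBall_zero_iff]
  constructor
  · rintro ⟨y, hy, rfl⟩
    rwa [scale_neg_scale]
  · intro h
    exact ⟨_, h, scale_scale_neg τ x⟩

/-! ### Systems of successively shortest vectors -/

/-- A maximal linearly independent system in `Λ` obtained by successively choosing shortest
vectors for the sup-norm. -/
structure IsMinimalSystem (Λ : Submodule ℤ (Fin d → ℝ)) {n : ℕ} (v : Fin n → Fin d → ℝ) :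
    Prop where
  linearIndependent : LinearIndependent ℝ v
  mem : ∀ i, v i ∈ Λ
  norm_le : ∀ k, ∀ z ∈ Λ, z ∉ Submodule.span ℝ (v '' Set.Iio k) → ‖v k‖ ≤ ‖z‖

theorem IsUnimodular.exists_shortest_notMem {Λ : Submodule ℤ (Fin d → ℝ)} (hΛ : IsUnimodular Λ)
    {V : Submodule ℝ (Fin d → ℝ)} (hV : V ≠ ⊤) :
    ∃ x ∈ Λ, x ∉ V ∧ ∀ z ∈ Λ, z ∉ V → ‖x‖ ≤ ‖z‖ := by
  obtain ⟨b, rfl, -⟩ := hΛ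
  obtain ⟨i, hi⟩ : ∃ i, b i ∉ V := by
    by_contra! h
    exact hV (top_le_iff.1 (b.span_eq ▸ Submodule.span_le.2 (Set.range_subset_iff.2 h)))
  have hbi : b i ∈ Submodule.span ℤ (Set.range b) := Submodule.subset_span ⟨i, rfl⟩
  have hfin : ((Metric.closedBall 0 ‖b i‖ ∩ Submodule.span ℤ (Set.range b)) \ V : Set (Fin d → ℝ)).Finite :=
    (ZSpan.setFinite_inter b Metric.isBounded_closedBall).subset Set.sdiff_subset
  obtain ⟨x, ⟨⟨hx1, hx2⟩, hx3⟩, hx⟩ := hfin.exists_minimalFor (fun x => ‖x‖) _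
    ⟨b i, ⟨by simp, hbi⟩, hi⟩
  refine ⟨x, hx2, hx3, fun z hz hzV => ?_⟩
  rcases le_total ‖x‖ ‖z‖ with h | h
  · exact h
  · exact hx ⟨⟨mem_closedBall_zero_iff.2 (h.trans (mem_closedBall_zero_iff.1 hx1)), hz⟩, hzV⟩ h

theorem IsUnimodular.exists_isMinimalSystem {Λ : Submodule ℤ (Fin d → ℝ)}
    (hΛ : IsUnimodular Λ) : ∃ v : Fin d → Fin d → ℝ, IsMinimalSystem Λ v := by
  suffices h : ∀ n ≤ d, ∃ v : Fin n → Fin d → ℝ, IsMinimalSystem Λ v from h d le_rfl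
  intro n
  induction n with
  | zero => exact fun _ => ⟨Fin.elim0, linearIndependent_empty_type, fun i => i.elim0,
      fun k => k.elim0⟩
  | succ n ih =>
    intro hn
    obtain ⟨v, hv⟩ := ih (by omega)
    have hV : Submodule.span ℝ (Set.range v) ≠ ⊤ := by
      intro h
      have := finrank_span_eq_card hv.linearIndependent
      rw [h, finrank_top, finrank_fin_fun, Fintype.card_fin] at this
      omega
    obtain ⟨x, hxΛ, hxV, hx⟩ := hΛ.exists_shortest_notMem hV
    refine ⟨Fin.snoc v x, linearIndependent_finSnoc.2 ⟨hv.linearIndependent, hxV⟩, ?_, ?_⟩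
    · exact Fin.lastCases (by simpa using hxΛ) (by simpa using hv.mem)
    · refine Fin.lastCases ?_ fun k => ?_
      · have : (Fin.snoc v x : Fin (n + 1) → Fin d → ℝ) '' Set.Iio (Fin.last n) =
            Set.range v := by
          ext y
          simp [Fin.exists_fin_succ', Set.mem_image]
        simpa [this] using hx
      · have : (Fin.snoc v x : Fin (n + 1) → Fin d → ℝ) '' Set.Iio k.castSucc =
            v '' Set.Iio k := by
          ext y
          simp [Fin.exists_fin_succ', Set.mem_image, (Fin.castSucc_lt_last k).not_gt]
        simpa [this] using hv.norm_le k

namespace IsMinimalSystem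

variable {Λ : Submodule ℤ (Fin d → ℝ)} {v : Fin d → Fin d → ℝ}

theorem norm_pos (hv : IsMinimalSystem Λ v) (k : Fin d) : 0 < ‖v k‖ :=
  norm_pos_iff.2 (hv.linearIndependent.ne_zero k)

theorem monotone (hv : IsMinimalSystem Λ v) : Monotone fun k => ‖v k‖ := by
  intro i j hij
  refine hv.norm_le i _ (hv.mem j) ?_
  exact hv.linearIndependent.notMem_span_image (by simpa using hij)

/-- Among more than `k` independent lattice vectors, one is at least as long as `v k`. -/
theorem exists_norm_le (hv : IsMinimalSystem Λ v) (k : Fin d) {ι : Type*} [Fintype ι]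
    {w : ι → Fin d → ℝ} (hw : LinearIndependent ℝ w) (hwΛ : ∀ i, w i ∈ Λ)
    (hk : (k : ℕ) < Fintype.card ι) : ∃ i, ‖v k‖ ≤ ‖w i‖ := by
  by_contra! h
  have hsub : ∀ i, w i ∈ Submodule.span ℝ (v '' Set.Iio k) := by
    intro i
    by_contra hi
    exact (h i).not_ge (hv.norm_le k _ (hwΛ i) hi)
  have h1 := Submodule.finrank_mono (Submodule.span_le.2 (Set.range_subset_iff.2 hsub))
  rw [finrank_span_eq_card hw] at h1
  have h2 := finrank_span_finset_le_card (R := ℝ) ((Finset.Iio k).image v)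
  have h3 := (Finset.Iio k).card_image_le (f := v)
  rw [Fin.card_Iio] at h3
  rw [Finset.coe_image, Finset.coe_Iio, Set.finrank] at h2
  omega

/-- The infimum is attained, so the admissible radii form a closed half-line. The shift by one
reconciles minima counted from 1 with `Fin d`. -/
theorem succMin_box {τ : Fin d → ℝ} (hv : IsMinimalSystem (scaleLattice (-τ) Λ) v) (k : Fin d) :
    succMin (box τ) Λ (k + 1) = ‖v k‖ := by
  have : {r : ℝ | 0 < r ∧ ∃ v : Fin (k + 1) → (Fin d → ℝ), LinearIndependent ℝ v ∧
      ∀ i, v i ∈ Λ ∧ v i ∈ (open scoped Pointwise in r • box τ)} = Set.Ici ‖v k‖ := by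
    ext r
    constructor
    · rintro ⟨hr, w, hw, hwr⟩
      obtain ⟨i, hi⟩ := hv.exists_norm_le k (w := fun i => scale (-τ) (w i))
        (hw.map' _ (LinearEquiv.ker (scale (-τ)))) (fun i => scale_mem_scaleLattice.2 (hwr i).1)
        (by simp)
      exact hi.trans ((mem_smul_box hr).1 (hwr i).2)
    · intro (hr : ‖v k‖ ≤ r)
      have hr0 := (hv.norm_pos k).trans_le hr
      have hlt : ∀ i : Fin (k + 1), (i : ℕ) < d := fun i => by omega
      refine ⟨hr0, fun i => scale τ (v ⟨i, hlt i⟩),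
        (hv.linearIndependent.comp _ ?_).map' _ (LinearEquiv.ker (scale τ)), fun i => ⟨?_, ?_⟩⟩
      · intro i j hij
        simpa [Fin.ext_iff] using hij
      · have := mem_scaleLattice.1 (hv.mem ⟨i, hlt i⟩)
        rwa [neg_neg] at this
      · rw [mem_smul_box hr0, scale_neg_scale]
        exact (hv.monotone (Fin.le_def.2 (Nat.lt_succ_iff.1 i.2))).trans hr
  rw [succMin, this, csInf_Ici]

theorem L_eq {τ : Fin d → ℝ} (hv : IsMinimalSystem (scaleLattice (-τ) Λ) v) (k : Fin d) :
    L (k + 1) τ Λ = Real.log ‖v k‖ := by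
  rw [L, hv.succMin_box]

/-- Minkowski's second theorem for the cube. -/
theorem prod_norm_le_one (hv : IsMinimalSystem Λ v) (hΛ : IsUnimodular Λ) : ∏ i, ‖v i‖ ≤ 1 := by
  obtain ⟨b, rfl, hb⟩ := hΛ
  let B := basisOfLinearIndependentOfCardEqFinrank' v hv.linearIndependent (by simp)
  have hB : ∀ i, B i = v i := fun i => by simp [B]
  rw [← hb]
  refine prod_le_abs_det B hv.monotone hv.norm_pos fun z hz k hzk => ?_
  by_contra hne
  refine hzk.not_ge (hv.norm_le k z hz fun hmem => hne ?_)
  have : Submodule.span ℝ (v '' Set.Iio k) ≤ LinearMap.ker (B.coord k) := by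
    rw [Submodule.span_le]
    rintro _ ⟨i, hi, rfl⟩
    rw [SetLike.mem_coe, LinearMap.mem_ker, ← hB, Basis.coord_apply, B.repr_self,
      Finsupp.single_eq_of_ne (ne_of_gt hi)]
  exact this hmem

end IsMinimalSystem

/-! ### Determinant estimates and integrality -/

theorem abs_det_le (M : Matrix (Fin d) (Fin d) ℝ) : |M.det| ≤ d.factorial * ∏ i, ‖M i‖ := by
  rw [← Matrix.det_transpose, Matrix.det_apply]
  refine (Finset.abs_sum_le_sum_abs _ _).trans ?_
  have : ∀ σ : Equiv.Perm (Fin d),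
      |Equiv.Perm.sign σ • ∏ i, M.transpose (σ i) i| ≤ ∏ i, ‖M i‖ := by
    intro σ
    rw [Units.smul_def, zsmul_eq_mul, abs_mul, Finset.abs_prod]
    have hs : |((Equiv.Perm.sign σ : ℤ) : ℝ)| = 1 := by
      rcases Int.units_eq_one_or (Equiv.Perm.sign σ) with h | h <;> simp [h]
    rw [hs, one_mul]
    exact Finset.prod_le_prod (fun i _ => abs_nonneg _) fun i _ => norm_le_pi_norm (M i) (σ i)
  refine (Finset.sum_le_card_nsmul _ _ _ fun σ _ => this σ).trans ?_
  simp [Fintype.card_perm]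

theorem IsUnimodular.exists_det_eq_intCast {Λ : Submodule ℤ (Fin d → ℝ)} (hΛ : IsUnimodular Λ)
    {x : Fin d → Fin d → ℝ} (hx : ∀ i, x i ∈ Λ) : ∃ n : ℤ, (Matrix.of x).det = n := by
  obtain ⟨b, rfl, hb⟩ := hΛ
  choose A hA using fun i => (b.mem_span_iff_repr_mem ℤ (x i)).1 (hx i)
  have : Matrix.of x = (Matrix.of A).map (Int.castRingHom ℝ) * Matrix.of b := by
    ext i j
    rw [Matrix.mul_apply]
    conv_lhs => rw [Matrix.of_apply, ← b.sum_repr (x i), Finset.sum_apply]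
    refine Finset.sum_congr rfl fun l _ => ?_
    rw [← hA]
    simp
  rw [this, Matrix.det_mul, ← RingHom.mapMatrix_apply, ← RingHom.map_det]
  rcases (abs_eq zero_le_one).1 hb with h | h
  · exact ⟨_, by rw [h, mul_one]; rfl⟩
  · exact ⟨-(Matrix.of A).det, by rw [h]; simp⟩

/-- The determinant of independent vectors of a unimodular lattice is a nonzero integer. -/
theorem IsMinimalSystem.one_le_factorial_mul_prod {Λ : Submodule ℤ (Fin d → ℝ)}
    {v : Fin d → Fin d → ℝ} (hv : IsMinimalSystem Λ v) (hΛ : IsUnimodular Λ) :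
    1 ≤ d.factorial * ∏ i, ‖v i‖ := by
  refine le_trans ?_ (abs_det_le (Matrix.of v))
  obtain ⟨n, hn⟩ := hΛ.exists_det_eq_intCast hv.mem
  have hne : (Matrix.of v).det ≠ 0 :=
    ((Matrix.isUnit_iff_isUnit_det _).1
      (Matrix.linearIndependent_rows_iff_isUnit.1 hv.linearIndependent)).ne_zero
  rw [hn] at hne ⊢
  exact_mod_cast Int.one_le_abs (by exact_mod_cast hne)

/-- Two linearly independent families with more than `d` members in total are not orthogonal. -/
theorem exists_dotProduct_ne_zero {ι κ : Type*} [Fintype ι] [Fintype κ] {v : ι → Fin d → ℝ}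
    {w : κ → Fin d → ℝ} (hv : LinearIndependent ℝ v) (hw : LinearIndependent ℝ w)
    (h : d < Fintype.card ι + Fintype.card κ) : ∃ i j, ∑ l, w j l * v i l ≠ 0 := by
  by_contra! hcon
  have hle : Submodule.span ℝ (Set.range w) ≤
      (stdForm d).orthogonal (Submodule.span ℝ (Set.range v)) := by
    rw [Submodule.span_le]
    rintro _ ⟨j, rfl⟩
    rw [SetLike.mem_coe, LinearMap.BilinForm.mem_orthogonal_iff]
    intro x hx
    have : Submodule.span ℝ (Set.range v) ≤ LinearMap.ker (stdForm d (w j)) := by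
      rw [Submodule.span_le]
      rintro _ ⟨i, rfl⟩
      exact hcon i j
    exact (dotProduct_comm x (w j)).trans (this hx)
  have h1 := Submodule.finrank_mono hle
  rw [LinearMap.BilinForm.finrank_orthogonal stdForm_nondegenerate,
    finrank_span_eq_card hv, finrank_span_eq_card hw, finrank_fin_fun] at h1
  have h2 := hv.fintype_card_le_finrank
  rw [finrank_fin_fun] at h2
  omega

/-! ### Transference between a lattice and its dual -/

namespace IsMinimalSystem

variable {Λ : Submodule ℤ (Fin d → ℝ)} {v w : Fin d → Fin d → ℝ}

theorem one_le_mul_norm_mul_norm (hv : IsMinimalSystem Λ v)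
    (hw : IsMinimalSystem (dualLattice Λ) w) (k : Fin d) : 1 ≤ d * (‖v k‖ * ‖w k.rev‖) := by
  obtain ⟨⟨i, hi⟩, ⟨j, hj⟩, hij⟩ := exists_dotProduct_ne_zero
    (hv.linearIndependent.comp (fun i : Finset.Iic k => (i : Fin d)) Subtype.val_injective)
    (hw.linearIndependent.comp (fun i : Finset.Iic k.rev => (i : Fin d)) Subtype.val_injective)
    (by rw [Fintype.card_coe, Fintype.card_coe, Fin.card_Iic, Fin.card_Iic, Fin.val_rev]; omega)
  rw [Finset.mem_Iic] at hi hj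
  obtain ⟨n, hn⟩ := (mem_dualLattice Λ (w j)).1 (hw.mem j) _ (hv.mem i)
  have h1 : (1 : ℝ) ≤ |∑ l, w j l * v i l| := by
    have : (n : ℝ) ≠ 0 := hn ▸ hij
    rw [hn]
    exact_mod_cast Int.one_le_abs (by exact_mod_cast this)
  refine h1.trans ((Finset.abs_sum_le_sum_abs _ _).trans ?_)
  have h2 : ∀ l, |w j l * v i l| ≤ ‖v k‖ * ‖w k.rev‖ := by
    intro l
    rw [abs_mul, mul_comm]
    exact mul_le_mul ((norm_le_pi_norm (v i) l).trans (hv.monotone hi))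
      ((norm_le_pi_norm (w j) l).trans (hw.monotone hj)) (abs_nonneg _) (norm_nonneg _)
  refine (Finset.sum_le_card_nsmul _ _ _ fun l _ => h2 l).trans ?_
  simp

theorem norm_mul_norm_le_factorial (hΛ : IsUnimodular Λ) (hv : IsMinimalSystem Λ v)
    (hw : IsMinimalSystem (dualLattice Λ) w) (k : Fin d) :
    ‖v k‖ * ‖w k.rev‖ ≤ d.factorial := by
  have hunit := Matrix.linearIndependent_rows_iff_isUnit.1
    (show LinearIndependent ℝ (Matrix.of v).row from hv.linearIndependent)
  -- Cofactor vectors: pairing `c j` with x gives the determinant with row j replaced by x (Cramer),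
  -- an integer for x in Λ.
  let c : Fin d → Fin d → ℝ := (Matrix.of v).adjugate.transpose
  have hc : LinearIndependent ℝ c := by
    refine Matrix.linearIndependent_rows_iff_isUnit.2 ((Matrix.isUnit_transpose _).2 ?_)
    rw [Matrix.isUnit_iff_isUnit_det, Matrix.det_adjugate]
    exact ((Matrix.isUnit_iff_isUnit_det _).1 hunit).pow _
  have hcΛ : ∀ j, c j ∈ dualLattice Λ := by
    intro j
    rw [mem_dualLattice]
    intro x hx
    obtain ⟨n, hn⟩ := hΛ.exists_det_eq_intCast (x := Function.update v j x) fun i => by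
      rcases eq_or_ne i j with rfl | h
      · simpa using hx
      · simpa [h] using hv.mem i
    refine ⟨n, hn ▸ ?_⟩
    have h := congrFun (Matrix.cramer_eq_adjugate_mulVec (Matrix.of v).transpose x) j
    rw [Matrix.cramer_transpose_apply, ← Matrix.adjugate_transpose] at h
    exact h.symm
  -- The indices j ≥ k number d - k, one more than `k.rev`; and j ≥ k also gives ‖v k‖ ≤ ‖v j‖.
  obtain ⟨⟨j, hj⟩, hwj⟩ := hw.exists_norm_le k.rev
    (hc.comp (fun i : Finset.Ici k => (i : Fin d)) Subtype.val_injective) (fun i => hcΛ i)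
    (by rw [Fintype.card_coe, Fin.card_Ici, Fin.val_rev]; omega)
  rw [Finset.mem_Ici] at hj
  have hcj : ‖c j‖ ≤ d.factorial * ∏ i ∈ Finset.univ \ {j}, ‖v i‖ := by
    refine (pi_norm_le_iff_of_nonneg (by positivity)).2 fun i => ?_
    have h := abs_det_le ((Matrix.of v).updateRow j (Pi.single i 1))
    rw [← Matrix.adjugate_apply] at h
    refine h.trans (le_of_eq ?_)
    congr 1
    have : ∀ l, ‖(Matrix.of v).updateRow j (Pi.single i 1) l‖ =
        Function.update (fun l => ‖v l‖) j 1 l := by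
      intro l
      rcases eq_or_ne l j with rfl | h
      · simp [Pi.norm_single]
      · rw [Matrix.updateRow_ne h, Function.update_of_ne h]
        rfl
    rw [Finset.prod_congr rfl fun l _ => this l, Finset.prod_update_of_mem (Finset.mem_univ j),
      one_mul]
  calc ‖v k‖ * ‖w k.rev‖ ≤ ‖v j‖ * (d.factorial * ∏ i ∈ Finset.univ \ {j}, ‖v i‖) :=
        mul_le_mul (hv.monotone hj) (hwj.trans hcj) (norm_nonneg _) (norm_nonneg _)
    _ = d.factorial * ∏ i, ‖v i‖ := by
        rw [← Finset.prod_sdiff (Finset.subset_univ {j}), Finset.prod_singleton]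
        ring
    _ ≤ d.factorial := mul_le_of_le_one_right (Nat.cast_nonneg _) (hv.prod_norm_le_one hΛ)

end IsMinimalSystem

/-! ### Summation over indices and the main theorem -/

theorem sum_Icc_reflect (g : ℕ → ℝ) {d k : ℕ} (hk : k ≤ d) :
    ∑ j ∈ Finset.Icc 1 k, g (d + 1 - j) + ∑ j ∈ Finset.Icc 1 (d - k), g j =
      ∑ j ∈ Finset.Icc 1 d, g j := by
  induction k with
  | zero => simp
  | succ k ih =>
    rw [← ih (by omega), Finset.sum_Icc_succ_top (by omega),
      show d - k = d - (k + 1) + 1 by omega, Finset.sum_Icc_succ_top (by omega),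
      show d + 1 - (k + 1) = d - (k + 1) + 1 by omega]
    ring

theorem sum_Icc_one_eq_sum_fin (g : ℕ → ℝ) (n : ℕ) :
    ∑ j ∈ Finset.Icc 1 n, g j = ∑ i : Fin n, g (i + 1) := by
  rw [← Finset.sum_range fun i => g (i + 1)]
  induction n with
  | zero => simp
  | succ n ih => rw [Finset.sum_Icc_succ_top (by omega), Finset.sum_range_succ, ih]

end MultParamGeom

theorem mainTheorem6 (d : ℕ) (Λ : Submodule ℤ (Fin d → ℝ)) [DiscreteTopology Λ] [IsZLattice ℝ Λ]
    (hΛ : ZLattice.covolume Λ = 1) (τ : Fin d → ℝ) (hτ : ∑ i, τ i = 0) :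
    (∀ k : ℕ, 1 ≤ k → k ≤ d →
      -Real.log (d : ℝ) ≤
          MultParamGeom.L k τ Λ
            + MultParamGeom.L (d + 1 - k) (-τ) (MultParamGeom.dualLattice Λ) ∧
        MultParamGeom.L k τ Λ
            + MultParamGeom.L (d + 1 - k) (-τ) (MultParamGeom.dualLattice Λ)
          ≤ Real.log (d.factorial : ℝ)) ∧
    (∀ k : ℕ, 1 ≤ k → k < d →
      -((k : ℝ) * Real.log (d : ℝ)) ≤
          MultParamGeom.S k τ Λ
            - MultParamGeom.S (d - k) (-τ) (MultParamGeom.dualLattice Λ) ∧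
        MultParamGeom.S k τ Λ
            - MultParamGeom.S (d - k) (-τ) (MultParamGeom.dualLattice Λ)
          ≤ ((k : ℝ) + 1) * Real.log (d.factorial : ℝ)) := by
  open MultParamGeom in
  have hU := isUnimodular_of_covolume_eq_one hΛ
  have hM : IsUnimodular (scaleLattice (-τ) Λ) := hU.scaleLattice (by simp [hτ])
  obtain ⟨v, hv⟩ := hM.exists_isMinimalSystem
  obtain ⟨w, hw⟩ := hM.dualLattice.exists_isMinimalSystem
  have hw' : IsMinimalSystem (scaleLattice (- -τ) (dualLattice Λ)) w := by
    rwa [neg_neg, ← dualLattice_scaleLattice]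
  have h1 : ∀ k : ℕ, 1 ≤ k → k ≤ d →
      -Real.log d ≤ L k τ Λ + L (d + 1 - k) (-τ) (dualLattice Λ) ∧
        L k τ Λ + L (d + 1 - k) (-τ) (dualLattice Λ) ≤ Real.log d.factorial := by
    intro k hk1 hkd
    obtain ⟨k, rfl⟩ : ∃ i : Fin d, k = i + 1 := ⟨⟨k - 1, by omega⟩, by simp; omega⟩
    have hd : (0 : ℝ) < d := by exact_mod_cast k.pos
    have hpos := mul_pos (hv.norm_pos k) (hw.norm_pos k.rev)
    rw [show d + 1 - (k + 1) = (k.rev : ℕ) + 1 by rw [Fin.val_rev]; omega, hv.L_eq, hw'.L_eq,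
      ← Real.log_mul (hv.norm_pos _).ne' (hw.norm_pos _).ne']
    refine ⟨?_, Real.log_le_log hpos (hv.norm_mul_norm_le_factorial hM hw k)⟩
    have := Real.log_nonneg (hv.one_le_mul_norm_mul_norm hw k)
    rw [Real.log_mul hd.ne' hpos.ne'] at this
    linarith
  have hS : S d (-τ) (dualLattice Λ) = Real.log (∏ i, ‖w i‖) := by
    rw [S, sum_Icc_one_eq_sum_fin, Real.log_prod fun i _ => (hw.norm_pos i).ne']
    exact Finset.sum_congr rfl fun i _ => hw'.L_eq i
  have hprod : 0 < ∏ i, ‖w i‖ := Finset.prod_pos fun i _ => hw.norm_pos i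
  have hS0 : S d (-τ) (dualLattice Λ) ≤ 0 :=
    hS ▸ Real.log_nonpos hprod.le (hw.prod_norm_le_one hM.dualLattice)
  have hS1 : -Real.log d.factorial ≤ S d (-τ) (dualLattice Λ) := by
    have := Real.log_nonneg (hw.one_le_factorial_mul_prod hM.dualLattice)
    rw [Real.log_mul (by positivity) hprod.ne', ← hS] at this
    linarith
  refine ⟨h1, fun k _ hkd => ?_⟩
  -- The dual terms in the sum of (i) add up to S_d - S_{d-k} of the dual lattice.
  have hrefl := sum_Icc_reflect (fun j => L j (-τ) (dualLattice Λ)) hkd.le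
  have hlow := Finset.card_nsmul_le_sum (Finset.Icc 1 k)
    (fun j => L j τ Λ + L (d + 1 - j) (-τ) (dualLattice Λ)) (-Real.log d) fun j hj =>
      (h1 j (Finset.mem_Icc.1 hj).1 ((Finset.mem_Icc.1 hj).2.trans hkd.le)).1
  have hup := Finset.sum_le_card_nsmul (Finset.Icc 1 k)
    (fun j => L j τ Λ + L (d + 1 - j) (-τ) (dualLattice Λ)) (Real.log d.factorial) fun j hj =>
      (h1 j (Finset.mem_Icc.1 hj).1 ((Finset.mem_Icc.1 hj).2.trans hkd.le)).2
  rw [Finset.sum_add_distrib, Nat.card_Icc, nsmul_eq_mul, Nat.add_sub_cancel] at hlow hup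
  rw [S] at hS0 hS1
  rw [S, S]
  constructor <;> linarith
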